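/- Let $H \neq 1$ be a finitely generated group, let $\langle t \rangle$ be an infinite cyclic group, and let $G = H \wr \langle t \rangle = \big(\bigoplus_{i \in \mathbb{Z}} H\big) \rtimes \langle t \rangle$ be their restricted standard wreath product, where $t$ acts on the direct sum by shifting the summands. For a finite generating set $S$ of $G$ and $n \in \mathbb{N}_0$, let $B_S(n)$ denote the ball of radius $n$ around $1$ in the Cayley graph of $G$ with respect to $S$, and let \[ \mathrm{dc}_S(G) = \limsup_{n \to \infty} \frac{\lvert \{ (g,h) \in B_S(n) \times B_S(n) \mid gh = hg \} \rvert}{\lvert B_S(n) \rvert^2} \] be the degree of commutativity of $G$ with respect to $S$. Then $\mathrm{dc}_S(G) = 0$ for every finite generating set $S$ of $G$. -/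

import Mathlib

/-- The restricted standard wreath product `H ≀ K`: the subgroup of the unrestricted regular wreath
product `(K → H) ⋊ K` consisting of the elements whose base coordinate has finite support, i.e.
`(⨁_{k ∈ K} H) ⋊ K` with `K` permuting the summands by translation. -/
def restrictedWreathProduct (H K : Type*) [Group H] [Group K] :
    Subgroup (RegularWreathProduct H K) where
  carrier := {g | (Function.mulSupport g.left).Finite}
  one_mem' := by simp
  mul_mem' := by
    intro a b ha hb
    simp only [Set.mem_ofPred_eq] at ha hb ⊢
    refine (ha.union (hb.image (fun x => a.right * x))).subset ?_
    intro x hx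
    by_contra hcon
    simp only [Set.mem_union, Function.mem_mulSupport, not_or, not_not, Set.mem_image,
      not_exists, not_and] at hcon
    obtain ⟨h1, h2⟩ := hcon
    have h3 : b.left (a.right⁻¹ * x) = 1 := by
      by_contra h
      exact h2 _ h (by simp)
    exact hx (by simp [h1, h3])
  inv_mem' := by
    intro a ha
    simp only [Set.mem_ofPred_eq] at ha ⊢
    refine (ha.image (fun x => a.right⁻¹ * x)).subset ?_
    intro x hx
    refine ⟨a.right * x, ?_, by simp⟩
    simpa [Function.mem_mulSupport] using hx

section DegreeOfCommutativity

variable {G : Type*} [Group G]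

/-- `cayleyBall S n` is the ball of radius `n` around `1` in the (undirected) Cayley graph of `G`
with respect to `S`. -/
def cayleyBall (S : Set G) (n : ℕ) : Set G :=
  {g | (SimpleGraph.mulCayley S).edist 1 g ≤ n}

/-- The proportion of commuting pairs in the square of the ball of radius `n`. -/
noncomputable def commutingRatio (S : Set G) (n : ℕ) : ℝ :=
  (({p : G × G | p.1 ∈ cayleyBall S n ∧ p.2 ∈ cayleyBall S n ∧ p.1 * p.2 = p.2 * p.1}).ncard : ℝ) /
    ((cayleyBall S n).ncard : ℝ) ^ 2

/-- The degree of commutativity of `G` with respect to the finite generating set `S`. -/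
noncomputable def degreeOfCommutativity (S : Set G) : ℝ :=
  Filter.limsup (commutingRatio S) Filter.atTop

/-- Balls with respect to finite sets are finite, so the cardinalities above are genuine. -/
theorem finite_cayleyBall {S : Set G} (hS : S.Finite) (n : ℕ) : (cayleyBall S n).Finite := by
  induction n with
  | zero =>
    refine (Set.finite_singleton (1 : G)).subset ?_
    intro g hg
    simpa [cayleyBall] using hg
  | succ n ih =>
    have hfin : (S ∪ S⁻¹ ∪ {1}).Finite := (hS.union hS.inv).union (Set.finite_singleton 1)
    refine (Set.Finite.image2 (fun g s => g * s) ih hfin).subset ?_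
    intro g hg
    have hg' : (SimpleGraph.mulCayley S).edist g 1 ≤ ((n + 1 : ℕ) : ℕ∞) := by
      rw [SimpleGraph.edist_comm]; exact hg
    obtain ⟨p, hp⟩ := SimpleGraph.exists_walk_of_edist_ne_top
      (ne_top_of_le_ne_top (ENat.natCast_ne_top _) hg')
    rw [← hp] at hg'
    cases p with
    | nil => exact ⟨1, by simp [cayleyBall], 1, by simp, by simp⟩
    | @cons _ v _ hadj q =>
      have hq : q.length ≤ n := by
        simpa using hg'
      refine ⟨v, ?_, v⁻¹ * g, ?_, by simp⟩
      · have h1 : (SimpleGraph.mulCayley S).edist 1 v ≤ q.length := by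
          rw [SimpleGraph.edist_comm]; exact SimpleGraph.edist_le q
        exact h1.trans (by exact_mod_cast hq)
      · rw [SimpleGraph.mulCayley_adj] at hadj
        rcases hadj.2 with h | h
        · exact Or.inl (Or.inr (by simpa using h))
        · exact Or.inl (Or.inl h)

/-- The ratios lie in `[0, 1]`, so that their real-valued `limsup` is the usual upper limit. -/
theorem commutingRatio_mem_Icc {S : Set G} (hS : S.Finite) (n : ℕ) :
    commutingRatio S n ∈ Set.Icc (0 : ℝ) 1 := by
  refine ⟨by unfold commutingRatio; positivity, ?_⟩
  refine div_le_one_of_le₀ ?_ (by positivity)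
  have hfin := finite_cayleyBall hS n
  have h : ({p : G × G | p.1 ∈ cayleyBall S n ∧ p.2 ∈ cayleyBall S n ∧
      p.1 * p.2 = p.2 * p.1}).ncard ≤ (cayleyBall S n ×ˢ cayleyBall S n).ncard :=
    Set.ncard_le_ncard (fun p hp => ⟨hp.1, hp.2.1⟩) (hfin.prod hfin)
  rw [Set.ncard_prod, ← sq] at h
  exact_mod_cast h

end DegreeOfCommutativity

/-! An element of `G` records a final position in ℤ and finitely many changed lamps. If `pos g ≠ 0`,
an element commuting with `g` is determined by its position (`eq_of_commute`). The ball of radius n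
meets only O(n) positions but grows faster than linearly, so pairs with a member outside the base
group `pos = 0` are negligible. It remains to see that the base group has density zero
(`exists_ncard_pos_zero_mul_le`). Enlarging the radius by a constant is harmless, since |B(n+k)| ≤
|B(n)||B(k)|.

Take a geodesic from 1 to an element of the base group. Suppose it stays in (-r, r) and has length
at least m. It can be torn apart at any of m times by inserting a fixed shift that moves the two
halves onto disjoint lamps. The result, with the position of the cut, recovers both the element and
the time, so for fixed r the proportion of such elements tends to 0 as m grows (`ncard_narrow_le`).

Suppose instead that it reaches distance r. Having to return, it has the form u v⁻¹ w, where v runs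
from the leftmost to the rightmost point of the way back. Reversing the middle part to u v w, with
short gaps, unfolds the walk injectively. Moreover u v⁻¹ = (u z)(v z)⁻¹, so z is free: placing two
extra bulbs gives quadratically many images, which outweighs the linearly many shapes unfolding to
the same position (`exists_ncard_wide_mul_le`).

Finally r is chosen first, then m, then n. -/

/-- A group `G` of lamplighter type: an element has a position in `ℤ` and a configuration
`ℤ → H` of lamps, and multiplication on the right by `g` acts on the lamps relative to the current
position. The group comes with a symmetric generating set `gens` each of whose members moves the
position by at most `reach` and only touches lamps within distance `reach`. -/
structure LampWalk (G H : Type*) [Group G] [Group H] where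
  pos : G → ℤ
  lamp : G → ℤ → H
  pos_mul : ∀ g g', pos (g * g') = pos g + pos g'
  lamp_mul : ∀ g g' x, lamp (g * g') x = lamp g x * lamp g' (x - pos g)
  ext : ∀ g g', pos g = pos g' → (∀ x, lamp g x = lamp g' x) → g = g'
  lamp_finite : ∀ g, ∃ N : ℤ, ∀ x, N < |x| → lamp g x = 1
  shift : G
  pos_shift : pos shift = 1
  lamp_shift : ∀ x, lamp shift x = 1
  bulb : G
  pos_bulb : pos bulb = 0
  lamp_bulb_zero : lamp bulb 0 ≠ 1
  lamp_bulb : ∀ x, x ≠ 0 → lamp bulb x = 1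
  gens : Set G
  gens_finite : gens.Finite
  gens_inv : ∀ s ∈ gens, s⁻¹ ∈ gens
  closure_gens : Subgroup.closure gens = ⊤
  reach : ℤ
  reach_nonneg : 0 ≤ reach
  pos_gens : ∀ s ∈ gens, |pos s| ≤ reach
  lamp_gens : ∀ s ∈ gens, ∀ x, reach < |x| → lamp s x = 1

/-! ### Positions, lamps and the mirror image -/

namespace LampWalk

variable {G H : Type*} [Group G] [Group H] (D : LampWalk G H)

theorem pos_one : D.pos 1 = 0 := by
  have := D.pos_mul 1 1
  simp at this
  exact this

theorem lamp_one (x : ℤ) : D.lamp 1 x = 1 := by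
  have := D.lamp_mul 1 1 x
  simpa [D.pos_one] using this

theorem pos_inv (g : G) : D.pos g⁻¹ = -D.pos g := by
  have := D.pos_mul g g⁻¹
  rw [mul_inv_cancel, D.pos_one] at this
  omega

theorem lamp_inv (g : G) (x : ℤ) : D.lamp g⁻¹ x = (D.lamp g (x + D.pos g))⁻¹ := by
  have := D.lamp_mul g g⁻¹ (x + D.pos g)
  rw [mul_inv_cancel, D.lamp_one, add_sub_cancel_right] at this
  exact eq_inv_of_mul_eq_one_right this.symm

/-- The position as a homomorphism. -/
def posHom : G →* Multiplicative ℤ where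
  toFun g := Multiplicative.ofAdd (D.pos g)
  map_one' := by simp [D.pos_one]
  map_mul' g g' := by simp [D.pos_mul]

theorem pos_zpow (g : G) (k : ℤ) : D.pos (g ^ k) = k * D.pos g := by
  have h := map_zpow D.posHom g k
  have h' : D.pos (g ^ k) = Multiplicative.toAdd (D.posHom (g ^ k)) := rfl
  rw [h', h]
  simp [posHom]

theorem pos_shift_zpow (k : ℤ) : D.pos (D.shift ^ k) = k := by
  rw [D.pos_zpow, D.pos_shift, mul_one]

theorem lamp_shift_zpow (k : ℤ) (x : ℤ) : D.lamp (D.shift ^ k) x = 1 := by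
  induction k generalizing x with
  | zero => simpa using D.lamp_one x
  | succ k ih => rw [zpow_add_one, D.lamp_mul, ih, D.lamp_shift, one_mul]
  | pred k ih => rw [zpow_sub_one, D.lamp_mul, ih, D.lamp_inv, D.lamp_shift]; simp

/-- The element that changes the lamp at distance `i` to the left and does not move. -/
def bulbAt (i : ℤ) : G := D.shift ^ (-i) * D.bulb * D.shift ^ i

theorem pos_bulbAt (i : ℤ) : D.pos (D.bulbAt i) = 0 := by
  simp only [bulbAt, D.pos_mul, D.pos_shift_zpow, D.pos_bulb]
  omega

theorem lamp_bulbAt (i x : ℤ) : D.lamp (D.bulbAt i) x = D.lamp D.bulb (x + i) := by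
  simp only [bulbAt, D.lamp_mul, D.lamp_shift_zpow, D.pos_shift_zpow, one_mul, mul_one,
    sub_neg_eq_add]

theorem lamp_bulbAt_of_ne {i x : ℤ} (h : x ≠ -i) : D.lamp (D.bulbAt i) x = 1 := by
  rw [lamp_bulbAt]
  exact D.lamp_bulb _ (by omega)

theorem lamp_bulbAt_self (i : ℤ) : D.lamp (D.bulbAt i) (-i) ≠ 1 := by
  rw [lamp_bulbAt]
  simpa using D.lamp_bulb_zero

/-- The two indices come from disjoint ranges, so the two changed lamps cannot be interchanged or
cancel. -/
theorem bulbAt_mul_bulbAt_inj {m M i j i' j' : ℤ} (hi : i < M + m) (hj : M + m ≤ j)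
    (hi' : i' < M + m) (hj' : M + m ≤ j')
    (h : D.bulbAt i * D.bulbAt j = D.bulbAt i' * D.bulbAt j') : i = i' ∧ j = j' := by
  have key : ∀ x, D.lamp (D.bulbAt i) x * D.lamp (D.bulbAt j) x =
      D.lamp (D.bulbAt i') x * D.lamp (D.bulbAt j') x := by
    intro x
    have := congrArg (fun g => D.lamp g x) h
    simpa [D.lamp_mul, D.pos_bulbAt] using this
  constructor
  · by_contra hne
    have h1 := key (-i)
    rw [D.lamp_bulbAt_of_ne (i := j) (by omega), D.lamp_bulbAt_of_ne (i := i') (by omega),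
      D.lamp_bulbAt_of_ne (i := j') (by omega)] at h1
    exact D.lamp_bulbAt_self i (by simpa using h1)
  · by_contra hne
    have h1 := key (-j)
    rw [D.lamp_bulbAt_of_ne (i := i) (by omega), D.lamp_bulbAt_of_ne (i := i') (by omega),
      D.lamp_bulbAt_of_ne (i := j') (by omega)] at h1
    exact D.lamp_bulbAt_self j (by simpa using h1)

/-- A product of two factors whose lamps lie on different sides of `p` determines the factors. -/
theorem mul_inj_of_separated {u u' y y' : G} {p : ℤ} (hpos : D.pos u = D.pos u')
    (hu : ∀ z, p ≤ z → D.lamp u z = 1) (hu' : ∀ z, p ≤ z → D.lamp u' z = 1)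
    (hy : ∀ z, z < p - D.pos u → D.lamp y z = 1) (hy' : ∀ z, z < p - D.pos u → D.lamp y' z = 1)
    (h : u * y = u' * y') : u = u' ∧ y = y' := by
  have huu : u = u' := by
    refine D.ext _ _ hpos fun z => ?_
    rcases lt_or_ge z p with hz | hz
    · have h1 := congrArg (fun g => D.lamp g z) h
      simp only [D.lamp_mul] at h1
      rw [← hpos, hy _ (by omega), hy' _ (by omega)] at h1
      simpa using h1
    · rw [hu z hz, hu' z hz]
  subst huu
  exact ⟨rfl, mul_left_cancel h⟩

/-- The same group seen in the mirror. -/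
def reflect : LampWalk G H where
  pos g := -D.pos g
  lamp g x := D.lamp g (-x)
  pos_mul g g' := by rw [D.pos_mul]; ring
  lamp_mul g g' x := by rw [D.lamp_mul]; congr 2; ring
  ext g g' h h' := D.ext _ _ (by omega) fun x => by simpa using h' (-x)
  lamp_finite g := by
    obtain ⟨N, hN⟩ := D.lamp_finite g
    exact ⟨N, fun x hx => hN _ (by rwa [abs_neg])⟩
  shift := D.shift⁻¹
  pos_shift := by rw [D.pos_inv, D.pos_shift]; rfl
  lamp_shift x := by rw [D.lamp_inv, D.lamp_shift, inv_one]
  bulb := D.bulb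
  pos_bulb := by rw [D.pos_bulb]; rfl
  lamp_bulb_zero := D.lamp_bulb_zero
  lamp_bulb x hx := D.lamp_bulb _ (by omega)
  gens := D.gens
  gens_finite := D.gens_finite
  gens_inv := D.gens_inv
  closure_gens := D.closure_gens
  reach := D.reach
  reach_nonneg := D.reach_nonneg
  pos_gens s hs := by rw [abs_neg]; exact D.pos_gens s hs
  lamp_gens s hs x hx := D.lamp_gens s hs _ (by rwa [abs_neg])

/-! ### Paths with constrained positions -/

/-- `D.WordPath P n x y`: there is a path of at most `n` steps from `x` to `y` all of whose
vertices have a position satisfying `P`. -/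
inductive WordPath (P : ℤ → Prop) : ℕ → G → G → Prop
  | refl (n : ℕ) (x : G) : P (D.pos x) → WordPath P n x x
  | step (n : ℕ) (x s y : G) : P (D.pos x) → s ∈ D.gens → WordPath P n (x * s) y →
      WordPath P (n + 1) x y

namespace WordPath

variable {D} {P Q : ℤ → Prop} {n m : ℕ} {x y z : G}

theorem start (h : D.WordPath P n x y) : P (D.pos x) := by
  cases h <;> assumption

theorem finish (h : D.WordPath P n x y) : P (D.pos y) := by
  induction h <;> assumption

theorem mono (h : D.WordPath P n x y) (hPQ : ∀ p, P p → Q p) : D.WordPath Q n x y := by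
  induction h with
  | refl n x h => exact .refl n x (hPQ _ h)
  | step n x s y h hs _ ih => exact .step n x s y (hPQ _ h) hs ih

theorem mono_length (h : D.WordPath P n x y) (hnm : n ≤ m) : D.WordPath P m x y := by
  induction h generalizing m with
  | refl n x h => exact .refl m x h
  | step n x s y h hs _ ih =>
    obtain ⟨m, rfl⟩ : ∃ m', m = m' + 1 := ⟨m - 1, by omega⟩
    exact .step m x s y h hs (ih (by omega))

theorem append (h : D.WordPath P n x y) (h' : D.WordPath P m y z) :
    D.WordPath P (n + m) x z := by
  induction h with
  | refl n x _ => exact h'.mono_length (by omega)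
  | step n x s y h hs _ ih =>
    rw [add_right_comm]
    exact .step _ x s z h hs (ih h')

theorem translate (h : D.WordPath P n x y) (g : G) (hPQ : ∀ p, P p → Q (D.pos g + p)) :
    D.WordPath Q n (g * x) (g * y) := by
  induction h with
  | refl n x h => exact .refl n _ (by rw [D.pos_mul]; exact hPQ _ h)
  | step n x s y h hs _ ih =>
    exact .step n _ s _ (by rw [D.pos_mul]; exact hPQ _ h) hs (by rwa [mul_assoc])

theorem single {s : G} (hx : P (D.pos x)) (hs : s ∈ D.gens) (hy : P (D.pos (x * s))) :
    D.WordPath P 1 x (x * s) :=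
  .step 0 x s _ hx hs (.refl 0 _ hy)

theorem symm (h : D.WordPath P n x y) : D.WordPath P n y x := by
  induction h with
  | refl n x h => exact .refl n x h
  | step n x s y h hs h' ih =>
    refine ih.append ?_
    have := single (D := D) (P := P) (x := x * s) (s := s⁻¹) h'.start (D.gens_inv s hs)
      (by simpa using h)
    simpa using this

/-- A path does not touch the lamps far from its vertices. -/
theorem lamp_eq (h : D.WordPath P n x y) {q : ℤ} (hq : ∀ p, P p → D.reach < |q - p|) :
    D.lamp y q = D.lamp x q := by
  induction h with
  | refl n x h => rfl
  | step n x s y h hs _ ih =>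
    rw [ih, D.lamp_mul, D.lamp_gens s hs _ (hq _ h), mul_one]

theorem exists_split (h : D.WordPath P n x y) {i : ℕ} (hi : i ≤ n) :
    ∃ z, D.WordPath P i x z ∧ D.WordPath P (n - i) z y := by
  induction h generalizing i with
  | refl n x h => exact ⟨x, .refl _ x h, .refl _ x h⟩
  | step n x s y h hs h' ih =>
    rcases i with _ | i
    · exact ⟨x, .refl _ x h, .step n x s y h hs h'⟩
    · obtain ⟨z, h1, h2⟩ := ih (i := i) (by omega)
      exact ⟨z, .step i x s z h hs h1, by simpa using h2⟩

/-- A path can be split at a vertex where a given function of the position is largest. -/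
theorem exists_split_max (h : D.WordPath P n x y) (f : ℤ → ℤ) :
    ∃ z n₁ n₂, n₁ + n₂ ≤ n ∧ D.WordPath (fun p => P p ∧ f p ≤ f (D.pos z)) n₁ x z ∧
      D.WordPath (fun p => P p ∧ f p ≤ f (D.pos z)) n₂ z y := by
  induction h with
  | refl n x h => exact ⟨x, 0, 0, by omega, .refl _ _ ⟨h, le_rfl⟩, .refl _ _ ⟨h, le_rfl⟩⟩
  | step n x s y h hs h' ih =>
    obtain ⟨z, n₁, n₂, hn, h1, h2⟩ := ih
    rcases le_total (f (D.pos x)) (f (D.pos z)) with hxz | hxz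
    · exact ⟨z, n₁ + 1, n₂, by omega, .step _ _ _ _ ⟨h, hxz⟩ hs h1, h2⟩
    · refine ⟨x, 0, n₁ + n₂ + 1, by omega, .refl _ _ ⟨h, le_rfl⟩,
        .step _ _ s _ ⟨h, le_rfl⟩ hs ?_⟩
      exact (h1.append h2).mono fun p hp => ⟨hp.1, hp.2.trans hxz⟩

/-- A path that rises above `θ` can be split so that its last part stays above `θ` and starts
near `θ`. -/
theorem exists_split_last (h : D.WordPath P n x y) {θ : ℤ} (hx : D.pos x ≤ θ)
    (hy : θ < D.pos y) :
    ∃ z n₁ n₂, n₁ + n₂ ≤ n ∧ D.WordPath P n₁ x z ∧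
      D.WordPath (fun p => P p ∧ θ < p) n₂ z y ∧ D.pos z ≤ θ + D.reach := by
  -- The assumption `D.pos x ≤ θ` fails at later vertices; allowing the alternative that the whole
  -- path lies above `θ` makes the induction work.
  have key : D.WordPath (fun p => P p ∧ θ < p) n x y ∨
      ∃ z n₁ n₂, n₁ + n₂ ≤ n ∧ D.WordPath P n₁ x z ∧
        D.WordPath (fun p => P p ∧ θ < p) n₂ z y ∧ D.pos z ≤ θ + D.reach := by
    clear hx
    induction h with
    | refl n x h => exact .inl (.refl _ _ ⟨h, hy⟩)
    | step n x s y h hs h' ih =>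
      rcases ih hy with h1 | ⟨z, n₁, n₂, hn, h1, h2, h3⟩
      · rcases lt_or_ge θ (D.pos x) with hx | hx
        · exact .inl (.step _ _ _ _ ⟨h, hx⟩ hs h1)
        · refine .inr ⟨x * s, 1, n, by omega, .single h hs h'.start, h1, ?_⟩
          have := (abs_le.1 (D.pos_gens s hs)).2
          rw [D.pos_mul]
          omega
      · exact .inr ⟨z, n₁ + 1, n₂, by omega, .step _ _ _ _ h hs h1, h2, h3⟩
  rcases key with h1 | h1
  · exact absurd h1.start.2 (by omega)
  · exact h1

theorem reflect (h : D.WordPath P n x y) : D.reflect.WordPath (fun p => P (-p)) n x y := by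
  induction h with
  | refl n x h => exact .refl _ _ (by simpa [LampWalk.reflect] using h)
  | step n x s y h hs _ ih => exact .step _ _ _ _ (by simpa [LampWalk.reflect] using h) hs ih

theorem of_reflect (h : D.reflect.WordPath P n x y) : D.WordPath (fun p => P (-p)) n x y := by
  induction h with
  | refl n x h => exact .refl _ _ h
  | step n x s y h hs _ ih => exact .step _ _ _ _ h hs ih

theorem abs_pos_sub_le (h : D.WordPath P n x y) : |D.pos y - D.pos x| ≤ n * D.reach := by
  induction h with
  | refl n x h => simpa using mul_nonneg (Int.natCast_nonneg n) D.reach_nonneg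
  | step n x s y h hs _ ih =>
    have := abs_le.1 (D.pos_gens s hs)
    rw [D.pos_mul] at ih
    rw [abs_le] at ih ⊢
    push_cast
    constructor <;> linarith

theorem bounded (h : D.WordPath P n x y) :
    D.WordPath (fun p => P p ∧ |p - D.pos x| ≤ n * D.reach) n x y := by
  have hr := D.reach_nonneg
  induction h with
  | refl n x h =>
    refine .refl _ _ ⟨h, by simpa using mul_nonneg (Int.natCast_nonneg n) hr⟩
  | step n x s y h hs _ ih =>
    refine .step _ _ _ _ ⟨h, by simp; positivity⟩ hs (ih.mono fun p hp => ⟨hp.1, ?_⟩)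
    have h1 := abs_le.1 (D.pos_gens s hs)
    have h2 := hp.2
    rw [D.pos_mul, abs_le] at h2
    rw [abs_le]
    push_cast
    constructor <;> linarith

end WordPath

theorem exists_wordPath (g : G) : ∃ n, D.WordPath (fun _ => True) n 1 g := by
  have hg : g ∈ Subgroup.closure D.gens := by rw [D.closure_gens]; trivial
  induction hg using Subgroup.closure_induction with
  | mem s hs => exact ⟨1, by simpa using WordPath.single (D := D) (x := 1) trivial hs trivial⟩
  | one => exact ⟨0, .refl _ _ trivial⟩
  | mul a b _ _ ha hb =>
    obtain ⟨n, ha⟩ := ha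
    obtain ⟨m, hb⟩ := hb
    exact ⟨n + m, ha.append (by simpa using hb.translate a (Q := fun _ => True) (by simp))⟩
  | inv a _ ha =>
    obtain ⟨n, ha⟩ := ha
    exact ⟨n, by simpa using (ha.translate a⁻¹ (Q := fun _ => True) (by simp)).symm⟩

/-! ### Balls in the word metric -/

/-- The ball of radius `n` in the word metric. -/
def ball (n : ℕ) : Set G := {g | D.WordPath (fun _ => True) n 1 g}

theorem ball_mono {n m : ℕ} (h : n ≤ m) : D.ball n ⊆ D.ball m :=
  fun _ hg => WordPath.mono_length hg h

theorem one_mem_ball (n : ℕ) : 1 ∈ D.ball n := .refl _ _ trivial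

theorem mul_mem_ball {n m : ℕ} {g h : G} (hg : g ∈ D.ball n) (hh : h ∈ D.ball m) :
    g * h ∈ D.ball (n + m) := by
  refine WordPath.append hg ?_
  simpa using hh.translate g (Q := fun _ => True) (by simp)

theorem inv_mem_ball {n : ℕ} {g : G} (hg : g ∈ D.ball n) : g⁻¹ ∈ D.ball n := by
  have := (WordPath.translate hg g⁻¹ (Q := fun _ => True) (by simp)).symm
  rwa [inv_mul_cancel, mul_one] at this

theorem inv_mul_mem_ball {P : ℤ → Prop} {n : ℕ} {x y : G} (h : D.WordPath P n x y) :
    x⁻¹ * y ∈ D.ball n := by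
  have := h.translate x⁻¹ (Q := fun _ => True) (by simp)
  rwa [inv_mul_cancel] at this

theorem ball_reflect (n : ℕ) : D.reflect.ball n = D.ball n := by
  ext g
  exact ⟨fun h => h.of_reflect, fun h => h.reflect⟩

theorem ball_add_subset (n m : ℕ) :
    D.ball (n + m) ⊆ (fun p : G × G => p.1 * p.2) '' (D.ball n ×ˢ D.ball m) := by
  intro g hg
  obtain ⟨z, h1, h2⟩ := WordPath.exists_split hg (i := n) (by omega)
  refine ⟨(z, z⁻¹ * g), ⟨h1, ?_⟩, by simp⟩
  simpa only [Nat.add_sub_cancel_left] using D.inv_mul_mem_ball h2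

theorem ball_one_subset : D.ball 1 ⊆ insert 1 D.gens := by
  intro g hg
  cases hg with
  | refl => simp
  | step n x s y _ hs h =>
    cases h with
    | refl => simp [hs]

theorem finite_ball (n : ℕ) : (D.ball n).Finite := by
  induction n with
  | zero =>
    refine (Set.finite_singleton 1).subset fun g hg => ?_
    cases hg with
    | refl => rfl
  | succ n ih =>
    exact ((ih.prod ((D.gens_finite.insert 1).subset D.ball_one_subset)).image _).subset
      (D.ball_add_subset n 1)

theorem ncard_ball_add_le (n m : ℕ) :
    (D.ball (n + m)).ncard ≤ (D.ball n).ncard * (D.ball m).ncard := by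
  have hf := (D.finite_ball n).prod (D.finite_ball m)
  rw [← Set.ncard_prod]
  exact (Set.ncard_le_ncard (D.ball_add_subset n m) (hf.image _)).trans (Set.ncard_image_le hf)

theorem ncard_ball_pos (n : ℕ) : 0 < (D.ball n).ncard :=
  (Set.ncard_pos (D.finite_ball n)).2 ⟨1, D.one_mem_ball n⟩

/-! ### Narrow elements -/

/-- The elements of the ball of radius `n` of length at least `m` that have a geodesic with
positions in `(-r, r)`. -/
def narrow (r : ℤ) (m n : ℕ) : Set G :=
  {g | ∃ l, m ≤ l ∧ l ≤ n ∧ D.WordPath (fun p => |p| < r) l 1 g ∧ ∀ k < l, g ∉ D.ball k}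

theorem narrow_subset_ball (r : ℤ) (m n : ℕ) : D.narrow r m n ⊆ D.ball n :=
  fun _ ⟨_, _, hl, h, _⟩ => (h.mono (Q := fun _ => True) (by simp)).mono_length hl

/-- The first factor touches only lamps below `r + D.reach`; the inserted shift by twice that amount
pushes the lamps of the second half to `r + D.reach` and beyond. So `mul_inj_of_separated` applies.
-/
theorem eq_of_mul_shift_mul_eq {r : ℤ} {i j i' j' : ℕ} {x x' g g' : G}
    (hx : D.WordPath (fun p => |p| < r) i 1 x) (hg : D.WordPath (fun p => |p| < r) j x g)
    (hx' : D.WordPath (fun p => |p| < r) i' 1 x') (hg' : D.WordPath (fun p => |p| < r) j' x' g')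
    (hpos : D.pos x = D.pos x')
    (h : x * (D.shift ^ (2 * r + 2 * D.reach) * (x⁻¹ * g)) =
      x' * (D.shift ^ (2 * r + 2 * D.reach) * (x'⁻¹ * g'))) : x = x' ∧ g = g' := by
  have left : ∀ {i x}, D.WordPath (fun p => |p| < r) i 1 x →
      ∀ z, r + D.reach ≤ z → D.lamp x z = 1 := by
    intro i x hx z hz
    rw [hx.lamp_eq, D.lamp_one]
    intro p hp
    rw [abs_lt] at hp
    rw [lt_abs]
    omega
  have right : ∀ {j x g}, D.WordPath (fun p => |p| < r) j x g →
      ∀ z, z < r + D.reach - D.pos x →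
        D.lamp (D.shift ^ (2 * r + 2 * D.reach) * (x⁻¹ * g)) z = 1 := by
    intro j x g hg z hz
    have h1 := hg.translate x⁻¹ (Q := fun p => |p + D.pos x| < r) fun p hp => by
      rw [D.pos_inv]
      simpa using hp
    rw [inv_mul_cancel] at h1
    rw [D.lamp_mul, D.lamp_shift_zpow, one_mul, D.pos_shift_zpow, h1.lamp_eq, D.lamp_one]
    intro p hp
    rw [abs_lt] at hp
    rw [lt_abs]
    omega
  obtain ⟨h1, h2⟩ := D.mul_inj_of_separated hpos (left hx) (left hx') (right hg)
    (by rw [hpos]; exact right hg') h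
  subst h1
  exact ⟨rfl, mul_left_cancel (mul_left_cancel h2)⟩

/-- Each of the first `m` vertices of the geodesic is a possible cut. The torn element and the
position of the cut determine the cut vertex and the element. -/
theorem ncard_narrow_le (r : ℕ) : ∃ c, ∀ m n,
    (D.narrow r m n).ncard * m ≤ (D.ball (n + c)).ncard * (2 * r) := by
  obtain ⟨c, hc⟩ := D.exists_wordPath (D.shift ^ (2 * (r : ℤ) + 2 * D.reach))
  refine ⟨c, fun m n => ?_⟩
  have key : ∀ g ∈ D.narrow r m n, ∀ i < m, ∃ x, D.WordPath (fun p => |p| < (r : ℤ)) i 1 x ∧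
      (∃ j, i + j ≤ n ∧ D.WordPath (fun p => |p| < (r : ℤ)) j x g) ∧ ∀ k < i, x ∉ D.ball k := by
    rintro g ⟨l, hml, hln, hg, hmin⟩ i hi
    obtain ⟨x, h1, h2⟩ := hg.exists_split (i := i) (by omega)
    refine ⟨x, h1, ⟨l - i, by omega, h2⟩, fun k hk hx => hmin (k + (l - i)) (by omega) ?_⟩
    exact WordPath.append hx (h2.mono (by simp))
  choose! x hx hj hmin using key
  have hmaps := Set.ncard_le_ncard_of_injOn
    (s := D.narrow r m n ×ˢ (Finset.range m : Set ℕ))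
    (t := D.ball (n + c) ×ˢ (Finset.Ico (-(r : ℤ)) r : Set ℤ))
    (fun p => (x p.1 p.2 * (D.shift ^ (2 * (r : ℤ) + 2 * D.reach) * ((x p.1 p.2)⁻¹ * p.1)),
      D.pos (x p.1 p.2))) ?_ ?_ ((D.finite_ball _).prod (Finset.finite_toSet _))
  · rwa [Set.ncard_prod, Set.ncard_prod, Set.ncard_coe_finset, Set.ncard_coe_finset,
      Finset.card_range, Int.card_Ico, show ((r : ℤ) - -r).toNat = 2 * r by omega] at hmaps
  · rintro ⟨g, i⟩ ⟨hg, hi⟩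
    simp only [Finset.coe_range, Set.mem_Iio] at hg hi
    obtain ⟨j, hij, hj⟩ := hj g hg i hi
    have hxi := hx g hg i hi
    refine ⟨?_, ?_⟩
    · refine D.ball_mono (n := i + (c + j)) (by omega) ?_
      exact D.mul_mem_ball (hxi.mono (by simp)) (D.mul_mem_ball hc (D.inv_mul_mem_ball hj))
    · have := abs_lt.1 hxi.finish
      simp only [Finset.coe_Ico, Set.mem_Ico]
      omega
  · rintro ⟨g, i⟩ ⟨hg, hi⟩ ⟨g', i'⟩ ⟨hg', hi'⟩ h
    simp only [Finset.coe_range, Set.mem_Iio] at hg hi hg' hi'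
    simp only [Prod.mk.injEq] at h
    obtain ⟨j, _, hj1⟩ := hj g hg i hi
    obtain ⟨j', _, hj2⟩ := hj g' hg' i' hi'
    obtain ⟨h1, rfl⟩ := D.eq_of_mul_shift_mul_eq (hx g hg i hi) hj1 (hx g' hg' i' hi') hj2 h.2 h.1
    -- The time is recovered as the word length of the cut vertex, because the path is geodesic.
    have hii : i = i' := by
      by_contra hne
      rcases lt_or_gt_of_ne hne with hlt | hlt
      · exact hmin g hg i' hi' i hlt (h1 ▸ (hx g hg i hi).mono (by simp))
      · exact hmin g hg i hi i' hlt (h1.symm ▸ (hx g hg' i' hi').mono (by simp))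
    rw [hii]

/-! ### Changing an extra lamp along a path -/

theorem exists_bulbAt_mem_ball (R : ℤ) : ∃ L, ∀ e, 0 ≤ e → e ≤ R → D.bulbAt e ∈ D.ball L := by
  choose f hf using fun e => D.exists_wordPath (D.bulbAt e)
  refine ⟨(Finset.Icc 0 R).sup f, fun e h0 hR => D.ball_mono (Finset.le_sup ?_) (hf e)⟩
  exact Finset.mem_Icc.2 ⟨h0, hR⟩

/-- Both sides change the same lamp, before and after `y`; the order is irrelevant as `y` leaves
that lamp alone. -/
theorem bulbAt_mul_eq {e i : ℤ} {y : G} (he : e = i - D.pos y) (hy : D.lamp y (-e) = 1) :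
    D.bulbAt e * y = y * D.bulbAt i := by
  refine D.ext _ _ (by simp only [D.pos_mul, D.pos_bulbAt]; ring) fun q => ?_
  rw [D.lamp_mul, D.lamp_mul, D.pos_bulbAt, sub_zero]
  rcases eq_or_ne q (-e) with rfl | hq
  · rw [hy, D.lamp_bulbAt, D.lamp_bulbAt, mul_one, one_mul]
    congr 1
    omega
  · rw [D.lamp_bulbAt_of_ne hq, D.lamp_bulbAt_of_ne (by omega), mul_one, one_mul]

/-- A path may be modified at bounded cost so as to change an additional lamp while passing by. -/
theorem exists_insert_bulb : ∃ L M : ℕ, ∀ (P : ℤ → Prop) (n : ℕ) (u : G) (i : ℤ),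
    D.WordPath P n 1 u → (∀ p, 0 ≤ p → p ≤ D.pos u → P p) → M ≤ i → i + M ≤ D.pos u →
    D.WordPath P (n + L) 1 (u * D.bulbAt i) := by
  obtain ⟨L, hL⟩ := D.exists_bulbAt_mem_ball (2 * D.reach)
  have hr := D.reach_nonneg
  have hLr : 0 ≤ L * D.reach := by positivity
  -- A detour of length `L` strays at most `L * D.reach` from its start, which is within `2 *
  -- D.reach` of the lamp; the margin `M` keeps it in `[0, D.pos u]`.
  obtain ⟨M, hM⟩ : ∃ M : ℕ, (M : ℤ) = 2 * D.reach + L * D.reach + 1 :=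
    ⟨(2 * D.reach + L * D.reach + 1).toNat, Int.toNat_of_nonneg (by omega)⟩
  refine ⟨L, M, fun P n u i hu hP hi hiu => ?_⟩
  -- The lamp to change sits at `D.pos u - i`. After `x` the path stays more than `D.reach` to its
  -- right, hence never touches it again.
  obtain ⟨x, n₁, n₂, hn, h1, h2, h3⟩ := hu.exists_split_last (θ := D.pos u - i + D.reach)
    (by rw [D.pos_one]; omega) (by omega)
  have hx := h2.start.2
  obtain ⟨e, he⟩ : ∃ e, e = i - (D.pos u - D.pos x) := ⟨_, rfl⟩
  have hcomm : D.bulbAt e * (x⁻¹ * u) = x⁻¹ * u * D.bulbAt i := by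
    refine D.bulbAt_mul_eq (by rw [D.pos_mul, D.pos_inv]; omega) ?_
    have h4 := h2.translate x⁻¹ (Q := fun p => D.pos u - i + D.reach < p + D.pos x) fun p hp => by
      rw [D.pos_inv]
      have := hp.2
      omega
    rw [inv_mul_cancel] at h4
    rw [h4.lamp_eq, D.lamp_one]
    intro p hp
    rw [lt_abs]
    omega
  have h5 : D.WordPath P L x (x * D.bulbAt e) := by
    have h6 := (WordPath.bounded (hL e (by omega) (by omega))).translate x (Q := P) fun p hp => by
      have h7 := abs_le.1 hp.2
      rw [D.pos_one] at h7
      exact hP _ (by omega) (by omega)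
    simpa using h6
  have h6 : D.WordPath P n₂ (x * D.bulbAt e) (u * D.bulbAt i) := by
    have h7 := h2.translate (x * D.bulbAt e * x⁻¹) (Q := P) fun p hp => by
      simp only [D.pos_mul, D.pos_inv, D.pos_bulbAt]
      simpa using hp.1
    have h8 : x * D.bulbAt e * x⁻¹ * u = u * D.bulbAt i := by
      rw [mul_assoc, mul_assoc, hcomm]
      group
    rwa [h8, inv_mul_cancel_right] at h7
  exact (h1.append (h5.append h6)).mono_length (by omega)

/-! ### Folded elements and their unfolding -/

/-- The products `u * v⁻¹ * w` where `u` leads to its rightmost position `b`, `v` leads from its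
leftmost to its rightmost position at distance `b + c`, and `w` starts at its leftmost position and
ends at `c`, the total length being at most `n`. -/
def folded (n b c : ℕ) : Set G :=
  {g | ∃ (u v w : G) (l₁ l₂ l₃ : ℕ), g = u * v⁻¹ * w ∧ l₁ + l₂ + l₃ ≤ n ∧
    (D.WordPath (fun p => p ≤ b) l₁ 1 u ∧ D.pos u = b) ∧
    (D.WordPath (fun p => 0 ≤ p ∧ p ≤ b + c) l₂ 1 v ∧ D.pos v = b + c) ∧
    (D.WordPath (fun p => 0 ≤ p) l₃ 1 w ∧ D.pos w = c)}

theorem folded_subset_ball (n b c : ℕ) : D.folded n b c ⊆ D.ball n := by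
  rintro g ⟨u, v, w, l₁, l₂, l₃, rfl, hn, hu, hv, hw⟩
  exact D.ball_mono hn (D.mul_mem_ball (D.mul_mem_ball (hu.1.mono (by simp))
    (D.inv_mem_ball (hv.1.mono (by simp)))) (hw.1.mono (by simp)))

theorem add_le_of_mem_folded {n b c : ℕ} {g : G} (h : g ∈ D.folded n b c) :
    (b + c : ℤ) ≤ n * D.reach := by
  obtain ⟨u, v, w, l₁, l₂, l₃, rfl, hn, hu, hv, hw⟩ := h
  have h1 := (abs_le.1 hv.1.abs_pos_sub_le).2
  rw [hv.2, D.pos_one, sub_zero] at h1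
  exact h1.trans (mul_le_mul_of_nonneg_right (by omega) D.reach_nonneg)

/-- Each factor reaches at most `D.reach` beyond its range of positions, so a gap of `2 * D.reach +
1` separates the lamps of consecutive factors, which are then peeled off from the left. -/
theorem unfold_inj {b d : ℤ} {l₁ l₂ l₃ l₁' l₂' l₃' : ℕ} {u v w u' v' w' : G}
    (hu : D.WordPath (fun p => p ≤ b) l₁ 1 u) (hub : D.pos u = b)
    (hv : D.WordPath (fun p => 0 ≤ p ∧ p ≤ d) l₂ 1 v) (hvd : D.pos v = d)
    (hw : D.WordPath (fun p => 0 ≤ p) l₃ 1 w)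
    (hu' : D.WordPath (fun p => p ≤ b) l₁' 1 u') (hub' : D.pos u' = b)
    (hv' : D.WordPath (fun p => 0 ≤ p ∧ p ≤ d) l₂' 1 v') (hvd' : D.pos v' = d)
    (hw' : D.WordPath (fun p => 0 ≤ p) l₃' 1 w')
    (h : u * (D.shift ^ (2 * D.reach + 1) * (v * (D.shift ^ (2 * D.reach + 1) * w))) =
      u' * (D.shift ^ (2 * D.reach + 1) * (v' * (D.shift ^ (2 * D.reach + 1) * w')))) :
    u = u' ∧ v = v' ∧ w = w' := by
  have hr := D.reach_nonneg
  have above : ∀ {P : ℤ → Prop} {l u} {b : ℤ}, D.WordPath P l 1 u → (∀ p, P p → p ≤ b) →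
      ∀ z, b + D.reach + 1 ≤ z → D.lamp u z = 1 := by
    intro P l u b hu hP z hz
    rw [hu.lamp_eq, D.lamp_one]
    intro p hp
    have := hP p hp
    rw [lt_abs]
    omega
  have below : ∀ {P : ℤ → Prop} {l u}, D.WordPath P l 1 u → (∀ p, P p → 0 ≤ p) →
      ∀ z, z < -D.reach → D.lamp u z = 1 := by
    intro P l u hu hP z hz
    rw [hu.lamp_eq, D.lamp_one]
    intro p hp
    have := hP p hp
    rw [lt_abs]
    omega
  have third : ∀ {l w}, D.WordPath (fun p => 0 ≤ p) l 1 w → ∀ z, z < D.reach + 1 →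
      D.lamp (D.shift ^ (2 * D.reach + 1) * w) z = 1 := by
    intro l w hw z hz
    rw [D.lamp_mul, D.lamp_shift_zpow, D.pos_shift_zpow, below hw (fun _ hp => hp) _ (by omega),
      one_mul]
  have second : ∀ {l l' v w}, D.WordPath (fun p => 0 ≤ p ∧ p ≤ d) l 1 v → D.pos v = d →
      D.WordPath (fun p => 0 ≤ p) l' 1 w → ∀ z, z < D.reach + 1 →
      D.lamp (D.shift ^ (2 * D.reach + 1) * (v * (D.shift ^ (2 * D.reach + 1) * w))) z = 1 := by
    intro l l' v w hv hvd hw z hz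
    have := hv.finish
    rw [D.lamp_mul, D.lamp_shift_zpow, D.pos_shift_zpow, D.lamp_mul,
      below hv (fun p hp => hp.1) _ (by omega), third hw _ (by omega), one_mul, one_mul]
  obtain ⟨h1, h2⟩ := D.mul_inj_of_separated (hub.trans hub'.symm) (above hu fun _ hp => hp)
    (above hu' fun _ hp => hp) (fun z hz => second hv hvd hw z (by omega))
    (fun z hz => second hv' hvd' hw' z (by omega)) h
  obtain ⟨h3, h4⟩ := D.mul_inj_of_separated (hvd.trans hvd'.symm)
    (above hv (b := d) (fun p hp => hp.2)) (above hv' (b := d) (fun p hp => hp.2))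
    (fun z hz => third hw z (by omega)) (fun z hz => third hw' z (by omega))
    (mul_left_cancel h2)
  exact ⟨h1, h3, mul_left_cancel h4⟩

/-- A folded element is sent to its unfolding with the same two bulbs appended to `u` and `v`. The
cost `k` covers four bulbs and two gaps. -/
theorem exists_ncard_folded_mul_le : ∃ k M : ℕ, ∀ n b c m : ℕ, 2 * M + 2 * m ≤ b →
    (D.folded n b c).ncard * (m * m) ≤
      ({g ∈ D.ball (n + k) | D.pos g = 2 * (b + c : ℤ) + 2 * (2 * D.reach + 1)}).ncard := by
  obtain ⟨L, M, hins⟩ := D.exists_insert_bulb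
  obtain ⟨K, hK⟩ := D.exists_wordPath (D.shift ^ (2 * D.reach + 1))
  refine ⟨4 * L + 2 * K, M, fun n b c m hm => ?_⟩
  choose! u v w l₁ l₂ l₃ hg hn hu hv hw using fun g (hg : g ∈ D.folded n b c) => hg
  have hins2 : ∀ (P : ℤ → Prop) (n : ℕ) (u : G) (i j : ℕ), D.WordPath P n 1 u →
      (∀ p, 0 ≤ p → p ≤ D.pos u → P p) → b ≤ D.pos u → i < m → j < m →
      D.WordPath P (n + 2 * L) 1 (u * (D.bulbAt (M + i : ℕ) * D.bulbAt (M + m + j : ℕ))) := by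
    intro P n u i j hu hP hb hi hj
    have h1 := hins P n u (M + i : ℕ) hu hP (by omega) (by omega)
    have hpos : D.pos (u * D.bulbAt (M + i : ℕ)) = D.pos u := by
      rw [D.pos_mul, D.pos_bulbAt, add_zero]
    have h2 := hins P _ _ (M + m + j : ℕ) h1 (by rwa [hpos]) (by omega) (by rw [hpos]; omega)
    rw [← mul_assoc]
    exact h2.mono_length (by omega)
  have hpos2 : ∀ u i j, D.pos (u * (D.bulbAt i * D.bulbAt j)) = D.pos u := by
    intro u i j
    simp only [D.pos_mul, D.pos_bulbAt, add_zero]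
  have hcard := Set.ncard_le_ncard_of_injOn
    (s := D.folded n b c ×ˢ ((Finset.range m : Set ℕ) ×ˢ (Finset.range m : Set ℕ)))
    (t := {g ∈ D.ball (n + (4 * L + 2 * K)) |
      D.pos g = 2 * (b + c : ℤ) + 2 * (2 * D.reach + 1)})
    (fun p => u p.1 * (D.bulbAt (M + p.2.1 : ℕ) * D.bulbAt (M + m + p.2.2 : ℕ)) *
      (D.shift ^ (2 * D.reach + 1) *
        (v p.1 * (D.bulbAt (M + p.2.1 : ℕ) * D.bulbAt (M + m + p.2.2 : ℕ)) *
          (D.shift ^ (2 * D.reach + 1) * w p.1)))) ?_ ?_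
    ((D.finite_ball _).subset fun _ h => h.1)
  · simpa [Set.ncard_prod] using hcard
  · rintro ⟨g, i, j⟩ ⟨hgf, hi, hj⟩
    simp only [Finset.coe_range, Set.mem_Iio] at hgf hi hj
    have hu1 := hins2 _ _ _ i j (hu g hgf).1 (fun p _ hp => by rwa [(hu g hgf).2] at hp)
      (hu g hgf).2.ge hi hj
    have hv1 := hins2 _ _ _ i j (hv g hgf).1 (fun p h0 hp => ⟨h0, by rwa [(hv g hgf).2] at hp⟩)
      (by rw [(hv g hgf).2]; omega) hi hj
    have hn1 := hn g hgf
    refine ⟨D.ball_mono (n := l₁ g + 2 * L + (K + (l₂ g + 2 * L + (K + l₃ g)))) (by omega) ?_, ?_⟩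
    · exact D.mul_mem_ball (hu1.mono (by simp)) (D.mul_mem_ball hK
        (D.mul_mem_ball (hv1.mono (by simp)) (D.mul_mem_ball hK ((hw g hgf).1.mono (by simp)))))
    · simp only [D.pos_mul, D.pos_bulbAt, D.pos_shift_zpow, (hu g hgf).2, (hv g hgf).2,
        (hw g hgf).2]
      ring
  · rintro ⟨g, i, j⟩ ⟨hgf, hi, hj⟩ ⟨g', i', j'⟩ ⟨hgf', hi', hj'⟩ h
    simp only [Finset.coe_range, Set.mem_Iio] at hgf hi hj hgf' hi' hj'
    have hu1 := hins2 _ _ _ i j (hu g hgf).1 (fun p _ hp => by rwa [(hu g hgf).2] at hp)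
      (hu g hgf).2.ge hi hj
    have hv1 := hins2 _ _ _ i j (hv g hgf).1 (fun p h0 hp => ⟨h0, by rwa [(hv g hgf).2] at hp⟩)
      (by rw [(hv g hgf).2]; omega) hi hj
    have hu2 := hins2 _ _ _ i' j' (hu g' hgf').1 (fun p _ hp => by rwa [(hu g' hgf').2] at hp)
      (hu g' hgf').2.ge hi' hj'
    have hv2 := hins2 _ _ _ i' j' (hv g' hgf').1
      (fun p h0 hp => ⟨h0, by rwa [(hv g' hgf').2] at hp⟩)
      (by rw [(hv g' hgf').2]; omega) hi' hj'
    obtain ⟨h1, h2, h3⟩ := D.unfold_inj hu1 ((hpos2 _ _ _).trans (hu g hgf).2) hv1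
      ((hpos2 _ _ _).trans (hv g hgf).2) (hw g hgf).1 hu2 ((hpos2 _ _ _).trans (hu g' hgf').2) hv2
      ((hpos2 _ _ _).trans (hv g' hgf').2) (hw g' hgf').1 h
    have hgg : g = g' := by
      -- The bulbs cancel on refolding, so `g` is recovered without knowing them. The chosen `u g`
      -- is then known too, and the bulbs can be read off.
      have hfold : ∀ u v w z : G, u * v⁻¹ * w = u * z * (v * z)⁻¹ * w := by intros; group
      rw [hg g hgf, hg g' hgf', hfold _ _ _ (D.bulbAt (M + i : ℕ) * D.bulbAt (M + m + j : ℕ)),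
        hfold (u g') _ _ (D.bulbAt (M + i' : ℕ) * D.bulbAt (M + m + j' : ℕ)), h1, h2, h3]
    subst hgg
    obtain ⟨h4, h5⟩ := D.bulbAt_mul_bulbAt_inj (M := M) (m := m) (by omega) (by omega) (by omega)
      (by omega) (mul_left_cancel h1)
    rw [show i = i' by omega, show j = j' by omega]

/-! ### Wide elements -/

/-- The elements folded at distance at least `r` to the right, where the part to the right of the
origin is at least as wide as the part to the left. -/
def wide (r n : ℕ) : Set G := {g | ∃ b c : ℕ, r ≤ b ∧ c ≤ b ∧ g ∈ D.folded n b c}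

/-- The position of the unfolding determines `s = b + c`, which leaves at most `s + 1` pairs. As `c
≤ b`, the gain `m * m` with `m` about `b / 2` exceeds `q * (s + 1)` for large `b`. -/
theorem exists_ncard_wide_mul_le : ∃ k : ℕ, ∀ q : ℕ, ∃ r₀ : ℕ, ∀ r ≥ r₀, ∀ n,
    (D.wide r n).ncard * q ≤ (D.ball (n + k)).ncard := by
  obtain ⟨k, M, hkM⟩ := D.exists_ncard_folded_mul_le
  refine ⟨k, fun q => ⟨2 * M + 2 * (4 * M + 5 + 6 * q), fun r hr n => ?_⟩⟩
  have hfib : ∀ b c : ℕ, r ≤ b → c ≤ b → (D.folded n b c).ncard * (q * (b + c + 1)) ≤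
      ({g ∈ D.ball (n + k) | D.pos g = 2 * ((b + c : ℕ) : ℤ) + 2 * (2 * D.reach + 1)}).ncard := by
    intro b c hb hc
    obtain ⟨m, hm⟩ : ∃ m, m = (b - 2 * M) / 2 := ⟨_, rfl⟩
    have h1 := hkM n b c m (by omega)
    push_cast
    refine (Nat.mul_le_mul_left _ ?_).trans h1
    calc q * (b + c + 1) ≤ q * (6 * m) := Nat.mul_le_mul_left _ (by omega)
      _ = (6 * q) * m := by ring
      _ ≤ m * m := Nat.mul_le_mul_right _ (by omega)
  obtain ⟨N, hN⟩ : ∃ N : ℕ, (N : ℤ) = n * D.reach + 1 :=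
    ⟨(n * D.reach + 1).toNat, Int.toNat_of_nonneg
      (by have := mul_nonneg (Int.natCast_nonneg n) D.reach_nonneg; omega)⟩
  have hsub : D.wide r n ⊆ ⋃ s ∈ Finset.range N, ⋃ b ∈ Finset.range (s + 1),
      {g | r ≤ b ∧ s - b ≤ b ∧ g ∈ D.folded n b (s - b)} := by
    rintro g ⟨b, c, hb, hc, hg⟩
    have h1 := D.add_le_of_mem_folded hg
    simp only [Set.mem_iUnion, Finset.mem_range]
    refine ⟨b + c, by omega, b, by omega, hb, by omega, by rwa [Nat.add_sub_cancel_left]⟩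
  have hfin : ∀ s b : ℕ, {g | r ≤ b ∧ s - b ≤ b ∧ g ∈ D.folded n b (s - b)}.Finite :=
    fun s b => (D.finite_ball n).subset fun g hg => D.folded_subset_ball n _ _ hg.2.2
  have hlevel : ∀ s, (⋃ b ∈ Finset.range (s + 1),
      {g | r ≤ b ∧ s - b ≤ b ∧ g ∈ D.folded n b (s - b)}).ncard * q ≤
      ({g ∈ D.ball (n + k) | D.pos g = 2 * (s : ℤ) + 2 * (2 * D.reach + 1)}).ncard := by
    intro s
    -- The factor `s + 1` counts the pieces of the union, each mapped into the same level set of the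
    -- position.
    refine Nat.le_of_mul_le_mul_right (c := s + 1) ?_ (by omega)
    calc _ ≤ (∑ b ∈ Finset.range (s + 1),
          {g | r ≤ b ∧ s - b ≤ b ∧ g ∈ D.folded n b (s - b)}.ncard) * q * (s + 1) := by
          gcongr
          exact Finset.set_ncard_biUnion_le _ _
      _ = ∑ b ∈ Finset.range (s + 1),
          {g | r ≤ b ∧ s - b ≤ b ∧ g ∈ D.folded n b (s - b)}.ncard * (q * (s + 1)) := by
          rw [mul_assoc, Finset.sum_mul]
      _ ≤ ∑ b ∈ Finset.range (s + 1),
          ({g ∈ D.ball (n + k) | D.pos g = 2 * (s : ℤ) + 2 * (2 * D.reach + 1)}).ncard := by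
          refine Finset.sum_le_sum fun b hb => ?_
          rw [Finset.mem_range] at hb
          by_cases h : r ≤ b ∧ s - b ≤ b
          · have h1 := hfib b (s - b) h.1 h.2
            rw [show b + (s - b) = s by omega] at h1
            simpa [h] using h1
          · have : {g | r ≤ b ∧ s - b ≤ b ∧ g ∈ D.folded n b (s - b)} = ∅ :=
              Set.eq_empty_of_forall_notMem fun g hg => h ⟨hg.1, hg.2.1⟩
            rw [this]
            simp
      _ = _ := by rw [Finset.sum_const, Finset.card_range, smul_eq_mul, mul_comm]
  classical
  have hB := D.finite_ball (n + k)
  calc (D.wide r n).ncard * q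
      ≤ (∑ s ∈ Finset.range N, (⋃ b ∈ Finset.range (s + 1),
        {g | r ≤ b ∧ s - b ≤ b ∧ g ∈ D.folded n b (s - b)}).ncard) * q := by
        gcongr
        refine (Set.ncard_le_ncard hsub ?_).trans (Finset.set_ncard_biUnion_le _ _)
        exact Set.Finite.biUnion (Finset.finite_toSet _) fun s _ =>
          Set.Finite.biUnion (Finset.finite_toSet _) fun b _ => hfin s b
    _ ≤ ∑ s ∈ Finset.range N,
        ({g ∈ D.ball (n + k) | D.pos g = 2 * (s : ℤ) + 2 * (2 * D.reach + 1)}).ncard := by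
        rw [Finset.sum_mul]
        exact Finset.sum_le_sum fun s _ => hlevel s
    _ = ∑ s ∈ Finset.range N,
        (hB.toFinset.filter fun g => D.pos g = 2 * (s : ℤ) + 2 * (2 * D.reach + 1)).card := by
        refine Finset.sum_congr rfl fun s _ => ?_
        rw [← Set.ncard_coe_finset]
        congr 1
        ext g
        simp
    _ = ((Finset.range N).biUnion fun s => hB.toFinset.filter
          fun g => D.pos g = 2 * (s : ℤ) + 2 * (2 * D.reach + 1)).card := by
        refine (Finset.card_biUnion fun s _ s' _ hss => ?_).symm
        refine Finset.disjoint_filter.2 fun g _ h1 h2 => ?_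
        exact hss (by omega)
    _ ≤ hB.toFinset.card := Finset.card_le_card (Finset.biUnion_subset.2 fun s _ =>
        Finset.filter_subset _ _)
    _ = (D.ball (n + k)).ncard := (Set.ncard_eq_toFinset_card _ hB).symm

/-! ### Decomposition of the base group -/

/-- The path is cut at its rightmost vertex `u` and at the leftmost vertex `y` after it. The
constrained path is returned as well, so that the mirrored statement can be applied to it. -/
theorem exists_mem_folded {P : ℤ → Prop} {n : ℕ} {g : G} (hg : D.WordPath P n 1 g)
    (hpos : D.pos g = 0) : ∃ b c : ℕ, g ∈ D.folded n b c ∧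
      D.WordPath (fun p => P p ∧ p ≤ b) n 1 g := by
  obtain ⟨u, l₁, l, hl, h1, h2⟩ := hg.exists_split_max id
  obtain ⟨y, l₂, l₃, hl', h3, h4⟩ := h2.exists_split_max (fun p => -p)
  have hb : 0 ≤ D.pos u := by simpa [D.pos_one] using h1.start.2
  have hc : D.pos y ≤ 0 := by simpa [hpos] using h4.finish.2
  obtain ⟨b, hb⟩ := Int.eq_ofNat_of_zero_le hb
  obtain ⟨c, hc⟩ := Int.eq_ofNat_of_zero_le (a := -D.pos y) (by omega)
  refine ⟨b, c, ⟨u, y⁻¹ * u, y⁻¹ * g, l₁, l₂, l₃, by group, by omega, ⟨?_, hb⟩, ⟨?_, ?_⟩, ?_, ?_⟩,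
    ?_⟩
  · exact h1.mono fun p hp => hb ▸ hp.2
  · have := h3.symm.translate y⁻¹ (Q := fun p => 0 ≤ p ∧ p ≤ b + c) fun p hp => by
      have h5 := hp.1.2
      have h6 := hp.2
      simp only [id] at h5
      rw [D.pos_inv]
      omega
    rwa [inv_mul_cancel] at this
  · rw [D.pos_mul, D.pos_inv]
    omega
  · have := h4.translate y⁻¹ (Q := fun p => 0 ≤ p) fun p hp => by
      have h6 := hp.2
      rw [D.pos_inv]
      omega
    rwa [inv_mul_cancel] at this
  · rw [D.pos_mul, D.pos_inv]
    omega
  · exact ((h1.append h2).mono_length hl).mono fun p hp => ⟨hp.1, hb ▸ hp.2⟩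

/-- Inversion reverses the three pieces and reflection restores their directions, exchanging `b` and
`c`. This makes `c ≤ b` harmless in the definition of `wide`. -/
theorem inv_mem_folded_reflect {n b c : ℕ} {g : G} (h : g ∈ D.folded n b c) :
    g⁻¹ ∈ D.reflect.folded n c b := by
  obtain ⟨u, v, w, l₁, l₂, l₃, rfl, hn, hu, hv, hw⟩ := h
  have hpos : ∀ g, D.reflect.pos g = -D.pos g := fun _ => rfl
  refine ⟨w⁻¹, v⁻¹, u⁻¹, l₃, l₂, l₁, by group, by omega, ⟨?_, ?_⟩, ⟨?_, ?_⟩, ?_, ?_⟩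
  · have h1 := (hw.1.translate w⁻¹ (Q := fun p => -c ≤ p) fun p hp => by
      rw [D.pos_inv, hw.2]; omega).symm.reflect
    rw [inv_mul_cancel, mul_one] at h1
    exact h1.mono fun p hp => by omega
  · rw [hpos, D.pos_inv, hw.2, neg_neg]
  · have h1 := (hv.1.translate v⁻¹ (Q := fun p => -(b + c) ≤ p ∧ p ≤ 0) fun p hp => by
      rw [D.pos_inv, hv.2]; omega).symm.reflect
    rw [inv_mul_cancel, mul_one] at h1
    exact h1.mono fun p hp => by omega
  · rw [hpos, D.pos_inv, hv.2]; omega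
  · have h1 := (hu.1.translate u⁻¹ (Q := fun p => p ≤ 0) fun p hp => by
      rw [D.pos_inv, hu.2]; omega).symm.reflect
    rw [inv_mul_cancel, mul_one] at h1
    exact h1.mono fun p hp => by omega
  · rw [hpos, D.pos_inv, hu.2, neg_neg]

theorem mem_wide_or_inv_mem_wide {n b c r : ℕ} {g : G} (h : g ∈ D.folded n b c) (hr : r ≤ b) :
    g ∈ D.wide r n ∨ g⁻¹ ∈ D.reflect.wide r n := by
  rcases le_total c b with hcb | hcb
  · exact .inl ⟨b, c, hr, hcb, h⟩
  · exact .inr ⟨c, b, hr.trans hcb, hcb, D.inv_mem_folded_reflect h⟩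

theorem mem_ball_cases {n r : ℕ} (m : ℕ) {g : G} (hg : g ∈ D.ball n) (hpos : D.pos g = 0) :
    g ∈ D.ball m ∨ g ∈ D.narrow r m n ∨ (g ∈ D.wide r n ∨ g⁻¹ ∈ D.reflect.wide r n) ∨
      (g ∈ D.reflect.wide r n ∨ g⁻¹ ∈ D.reflect.reflect.wide r n) := by
  classical
  -- The least radius `l` makes the path geodesic, as `narrow` demands.
  have hex : ∃ l, g ∈ D.ball l := ⟨n, hg⟩
  have hl := Nat.find_spec hex
  have hmin : ∀ k < Nat.find hex, g ∉ D.ball k := fun k hk => Nat.find_min hex hk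
  have hln : Nat.find hex ≤ n := Nat.find_min' hex hg
  generalize Nat.find hex = l at hl hmin hln
  rcases le_total l m with hlm | hlm
  · exact .inl (D.ball_mono hlm hl)
  obtain ⟨b, c, hbc, h1⟩ := D.exists_mem_folded (hl : D.WordPath _ l 1 g) hpos
  obtain ⟨b', c', hbc', h2⟩ := D.reflect.exists_mem_folded h1.reflect
    (by show -D.pos g = 0; omega)
  have folded_mono : ∀ (E : LampWalk G H) (b c : ℕ), E.folded l b c ⊆ E.folded n b c := by
    rintro E b c x ⟨u, v, w, l₁, l₂, l₃, h, h', h''⟩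
    exact ⟨u, v, w, l₁, l₂, l₃, h, h'.trans hln, h''⟩
  by_cases hb : r ≤ b
  · exact .inr (.inr (.inl (D.mem_wide_or_inv_mem_wide (folded_mono _ _ _ hbc) hb)))
  by_cases hb' : r ≤ b'
  · exact .inr (.inr (.inr (D.reflect.mem_wide_or_inv_mem_wide (folded_mono _ _ _ hbc') hb')))
  refine .inr (.inl ⟨l, hlm, hln, h2.of_reflect.mono fun p hp => ?_, hmin⟩)
  obtain ⟨⟨_, h3⟩, h4⟩ := hp
  rw [abs_lt]
  omega

/-! ### Growth -/

theorem shift_zpow_mem_ball {a : ℕ} (ha : D.shift ∈ D.ball a) (i : ℕ) :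
    D.shift ^ (i : ℤ) ∈ D.ball (i * a) := by
  induction i with
  | zero => simpa using D.one_mem_ball 0
  | succ i ih =>
    rw [Nat.cast_succ, zpow_add_one, Nat.succ_mul]
    exact D.mul_mem_ball ih ha

/-- The group grows at least quadratically. -/
theorem exists_sq_le_ncard_ball : ∃ k : ℕ, 0 < k ∧ ∀ m, m * m ≤ (D.ball (k * m)).ncard := by
  obtain ⟨a, ha⟩ := D.exists_wordPath D.shift
  obtain ⟨b, hb⟩ := D.exists_wordPath D.bulb
  refine ⟨2 * a + b + 1, by omega, fun m => ?_⟩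
  have h := Set.ncard_le_ncard_of_injOn
    (s := (Finset.range m : Set ℕ) ×ˢ (Finset.range m : Set ℕ)) (t := D.ball ((2 * a + b + 1) * m))
    -- The only changed lamp gives `i`, and the position then gives `j`.
    (fun p => D.shift ^ (p.1 : ℤ) * D.bulb * D.shift ^ (p.2 : ℤ)) ?_ ?_ (D.finite_ball _)
  · simpa [Set.ncard_prod] using h
  · rintro ⟨i, j⟩ ⟨hi, hj⟩
    simp only [Finset.coe_range, Set.mem_Iio] at hi hj
    refine D.ball_mono (n := i * a + b + j * a) ?_ (D.mul_mem_ball (D.mul_mem_ball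
      (D.shift_zpow_mem_ball ha i) hb) (D.shift_zpow_mem_ball ha j))
    have h1 : i * a ≤ m * a := Nat.mul_le_mul_right _ hi.le
    have h2 : j * a ≤ m * a := Nat.mul_le_mul_right _ hj.le
    have h3 : b ≤ m * b := Nat.le_mul_of_pos_left _ (by omega)
    have h4 : (2 * a + b + 1) * m = 2 * (m * a) + m * b + m := by ring
    omega
  · rintro ⟨i, j⟩ _ ⟨i', j'⟩ _ hij
    have hlamp := congrArg (fun g => D.lamp g i) hij
    have hpos := congrArg D.pos hij
    simp only [D.lamp_mul, D.pos_mul, D.pos_shift_zpow, D.lamp_shift_zpow, D.pos_bulb, one_mul,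
      mul_one, sub_self] at hlamp hpos
    have hii : i = i' := by
      by_contra hne
      rw [D.lamp_bulb ((i : ℤ) - i') (by omega)] at hlamp
      exact D.lamp_bulb_zero hlamp
    subst hii
    simp only [Prod.mk.injEq, true_and]
    omega

theorem exists_mul_le_ncard_ball (A : ℕ) : ∃ N, ∀ n ≥ N, A * n ≤ (D.ball n).ncard := by
  obtain ⟨k, hk, h⟩ := D.exists_sq_le_ncard_ball
  refine ⟨k * (2 * A * k + 1), fun n hn => ?_⟩
  obtain ⟨m, hm⟩ : ∃ m, m = n / k := ⟨_, rfl⟩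
  have h1 : 2 * A * k + 1 ≤ m := by
    rw [hm, Nat.le_div_iff_mul_le hk, mul_comm]
    exact hn
  have h2 : k * m ≤ n := hm ▸ Nat.mul_div_le n k
  have h3 : n ≤ k * (m + 1) := hm ▸ (Nat.lt_mul_div_succ n hk).le
  calc A * n ≤ A * (k * (m + m)) := by
        refine Nat.mul_le_mul_left _ (h3.trans (Nat.mul_le_mul_left _ (by omega)))
    _ = (2 * A * k) * m := by ring
    _ ≤ m * m := Nat.mul_le_mul_right _ (by omega)
    _ ≤ (D.ball (k * m)).ncard := h m
    _ ≤ (D.ball n).ncard := Set.ncard_le_ncard (D.ball_mono h2) (D.finite_ball n)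

/-! ### Density of the base group -/

theorem wide_subset_ball (r n : ℕ) : D.wide r n ⊆ D.ball n :=
  fun _ ⟨_, _, _, _, hg⟩ => D.folded_subset_ball _ _ _ hg

theorem exists_ncard_wide_mul_le_ncard_ball (q : ℕ) : ∃ r₀, ∀ r ≥ r₀, ∀ n,
    (D.wide r n).ncard * q ≤ (D.ball n).ncard := by
  obtain ⟨k, hk⟩ := D.exists_ncard_wide_mul_le
  -- The extra factor pays for shrinking the radius from `n + k` to `n`.
  obtain ⟨r₀, h⟩ := hk (q * (D.ball k).ncard)
  refine ⟨r₀, fun r hr n => Nat.le_of_mul_le_mul_right (c := (D.ball k).ncard) ?_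
    (D.ncard_ball_pos k)⟩
  rw [mul_assoc]
  exact (h r hr n).trans (D.ncard_ball_add_le n k)

theorem ncard_inv_mem_le {A : Set G} (hA : A.Finite) : {g | g⁻¹ ∈ A}.ncard ≤ A.ncard :=
  Set.ncard_le_ncard_of_injOn (fun g => g⁻¹) (fun _ hg => hg) inv_injective.injOn hA

theorem ncard_ball_pos_zero_le (r m n : ℕ) :
    {g ∈ D.ball n | D.pos g = 0}.ncard ≤ (D.ball m).ncard + (D.narrow r m n).ncard +
      (D.wide r n).ncard + 2 * (D.reflect.wide r n).ncard +
        (D.reflect.reflect.wide r n).ncard := by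
  have hw : ∀ E : LampWalk G H, (E.wide r n).Finite :=
    fun E => (E.finite_ball n).subset (E.wide_subset_ball r n)
  have hsub : {g ∈ D.ball n | D.pos g = 0} ⊆ D.ball m ∪ (D.narrow r m n ∪
      ((D.wide r n ∪ {g | g⁻¹ ∈ D.reflect.wide r n}) ∪
        (D.reflect.wide r n ∪ {g | g⁻¹ ∈ D.reflect.reflect.wide r n}))) :=
    fun g hg => D.mem_ball_cases m hg.1 hg.2
  have hinv : ∀ E : LampWalk G H, {g | g⁻¹ ∈ E.wide r n}.Finite :=
    fun E => (hw E).preimage inv_injective.injOn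
  have hn := (D.finite_ball n).subset (D.narrow_subset_ball r m n)
  have h0 := Set.ncard_le_ncard hsub ((D.finite_ball m).union (hn.union
    (((hw D).union (hinv _)).union ((hw _).union (hinv _)))))
  have h1 := Set.ncard_union_le (D.ball m) (D.narrow r m n ∪
      ((D.wide r n ∪ {g | g⁻¹ ∈ D.reflect.wide r n}) ∪
        (D.reflect.wide r n ∪ {g | g⁻¹ ∈ D.reflect.reflect.wide r n})))
  have h2 := Set.ncard_union_le (D.narrow r m n)
      ((D.wide r n ∪ {g | g⁻¹ ∈ D.reflect.wide r n}) ∪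
        (D.reflect.wide r n ∪ {g | g⁻¹ ∈ D.reflect.reflect.wide r n}))
  have h3 := Set.ncard_union_le (D.wide r n ∪ {g | g⁻¹ ∈ D.reflect.wide r n})
        (D.reflect.wide r n ∪ {g | g⁻¹ ∈ D.reflect.reflect.wide r n})
  have h4 := Set.ncard_union_le (D.wide r n) {g | g⁻¹ ∈ D.reflect.wide r n}
  have h5 := Set.ncard_union_le (D.reflect.wide r n) {g | g⁻¹ ∈ D.reflect.reflect.wide r n}
  have h6 := ncard_inv_mem_le (hw D.reflect)
  have h7 := ncard_inv_mem_le (hw D.reflect.reflect)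
  omega

/-- The base group has density zero. -/
theorem exists_ncard_pos_zero_mul_le (q : ℕ) : ∃ N, ∀ n ≥ N,
    {g ∈ D.ball n | D.pos g = 0}.ncard * q ≤ (D.ball n).ncard := by
  -- The bound in `ncard_ball_pos_zero_le` has six terms, counted with multiplicity; each is made at
  -- most a `6 * q`-th of the ball.
  obtain ⟨r₁, h₁⟩ := D.exists_ncard_wide_mul_le_ncard_ball (6 * q)
  obtain ⟨r₂, h₂⟩ := D.reflect.exists_ncard_wide_mul_le_ncard_ball (6 * q)
  obtain ⟨r₃, h₃⟩ := D.reflect.reflect.exists_ncard_wide_mul_le_ncard_ball (6 * q)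
  obtain ⟨r, hr⟩ : ∃ r, r = r₁ + r₂ + r₃ + 1 := ⟨_, rfl⟩
  obtain ⟨c, hc⟩ := D.ncard_narrow_le r
  obtain ⟨m, hm⟩ : ∃ m, m = 6 * q * ((D.ball c).ncard * (2 * r)) := ⟨_, rfl⟩
  obtain ⟨N, hN⟩ := D.exists_mul_le_ncard_ball ((D.ball m).ncard * (6 * q))
  refine ⟨N + 1, fun n hn => ?_⟩
  have e1 := h₁ r (by omega) n
  have e2 := h₂ r (by omega) n
  have e3 := h₃ r (by omega) n
  rw [ball_reflect] at e2
  rw [ball_reflect, ball_reflect] at e3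
  have e4 : (D.narrow r m n).ncard * (6 * q) ≤ (D.ball n).ncard := by
    refine Nat.le_of_mul_le_mul_right (c := (D.ball c).ncard * (2 * r)) ?_
      (Nat.mul_pos (D.ncard_ball_pos c) (by omega))
    calc _ = (D.narrow r m n).ncard * m := by rw [hm]; ring
      _ ≤ (D.ball (n + c)).ncard * (2 * r) := hc m n
      _ ≤ (D.ball n).ncard * (D.ball c).ncard * (2 * r) :=
        Nat.mul_le_mul_right _ (D.ncard_ball_add_le n c)
      _ = _ := by ring
  have e5 : (D.ball m).ncard * (6 * q) ≤ (D.ball n).ncard :=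
    (Nat.le_mul_of_pos_right _ (by omega)).trans (hN n (by omega))
  have e6 := Nat.mul_le_mul_right q (D.ncard_ball_pos_zero_le r m n)
  refine Nat.le_of_mul_le_mul_right (c := 6) ?_ (by omega)
  nlinarith

/-! ### Commuting pairs -/

/-- An element that moves the position commutes with no nontrivial element that does not. -/
theorem eq_of_commute {g h h' : G} (hg : D.pos g ≠ 0) (h1 : g * h = h * g) (h2 : g * h' = h' * g)
    (hpos : D.pos h = D.pos h') : h = h' := by
  obtain ⟨x, rfl⟩ : ∃ x, h' = h * x := ⟨h⁻¹ * h', by group⟩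
  rw [D.pos_mul] at hpos
  have hx : D.pos x = 0 := by omega
  have hcomm : g * x = x * g := by
    rw [← mul_assoc, h1, mul_assoc, mul_assoc] at h2
    exact mul_left_cancel h2
  -- Comparing lamp `q` in `g * x = x * g`: the support of `x` is stable under translation by
  -- `-D.pos g`, so being finite it is empty.
  have hstep : ∀ q, D.lamp x q ≠ 1 → D.lamp x (q - D.pos g) ≠ 1 := by
    intro q hq h
    have := congrArg (fun y => D.lamp y q) hcomm
    simp only [D.lamp_mul, h, hx, sub_zero, mul_one] at this
    exact hq (by simpa using this)
  have hiter : ∀ q, D.lamp x q ≠ 1 → ∀ k : ℕ, D.lamp x (q - k * D.pos g) ≠ 1 := by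
    intro q hq k
    induction k with
    | zero => simpa using hq
    | succ k ih =>
      have := hstep _ ih
      rwa [sub_sub, ← add_one_mul, ← Nat.cast_succ] at this
  have hx1 : x = 1 := by
    refine D.ext _ _ (by rw [hx, D.pos_one]) fun q => ?_
    rw [D.lamp_one]
    by_contra hq
    obtain ⟨N, hN⟩ := D.lamp_finite x
    refine hiter q hq (|N| + |q| + 1).toNat (hN _ ?_)
    have hk : (((|N| + |q| + 1).toNat : ℕ) : ℤ) = |N| + |q| + 1 :=
      Int.toNat_of_nonneg (by positivity)
    rw [hk]
    have h3 : |N| + |q| + 1 ≤ |(|N| + |q| + 1) * D.pos g| := by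
      rw [abs_mul, abs_of_nonneg (a := |N| + |q| + 1) (by positivity)]
      exact le_mul_of_one_le_right (by positivity) (Int.one_le_abs hg)
    have h4 := abs_sub_abs_le_abs_sub ((|N| + |q| + 1) * D.pos g) q
    rw [abs_sub_comm] at h4
    have := le_abs_self N
    omega
  rw [hx1, mul_one]

/-- The pairs of commuting elements of the ball of radius `n`. -/
def commutingPairs (n : ℕ) : Set (G × G) :=
  {p | p.1 ∈ D.ball n ∧ p.2 ∈ D.ball n ∧ p.1 * p.2 = p.2 * p.1}

/-- Pairs inside the base group number at most β². The others are injected into element times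
position, once for each member that may move. Each kind takes at most half of the allowed share. -/
theorem exists_ncard_commutingPairs_mul_le (q : ℕ) : ∃ N, ∀ n ≥ N,
    (D.commutingPairs n).ncard * q ≤ (D.ball n).ncard ^ 2 := by
  obtain ⟨C, hC⟩ := Int.eq_ofNat_of_zero_le D.reach_nonneg
  obtain ⟨N₁, h₁⟩ := D.exists_ncard_pos_zero_mul_le (2 * q + 1)
  obtain ⟨N₂, h₂⟩ := D.exists_mul_le_ncard_ball (4 * q * (2 * C + 1))
  refine ⟨N₁ + N₂ + 1, fun n hn => ?_⟩
  have hB := D.finite_ball n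
  have hfin : (D.commutingPairs n).Finite := (hB.prod hB).subset fun p hp => ⟨hp.1, hp.2.1⟩
  have hpos : ∀ g ∈ D.ball n, D.pos g ∈ (Finset.Icc (-(n * C : ℕ) : ℤ) (n * C : ℕ) : Set ℤ) := by
    intro g hg
    have := WordPath.abs_pos_sub_le hg
    rw [D.pos_one, sub_zero, hC, abs_le] at this
    simpa using this
  have hcardI : (D.ball n ×ˢ (Finset.Icc (-(n * C : ℕ) : ℤ) (n * C : ℕ) : Set ℤ)).ncard =
      (D.ball n).ncard * (2 * (n * C) + 1) := by
    rw [Set.ncard_prod, Set.ncard_coe_finset, Int.card_Icc]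
    congr 1
    omega
  have e1 : {p ∈ D.commutingPairs n | D.pos p.1 ≠ 0}.ncard ≤
      (D.ball n).ncard * (2 * (n * C) + 1) := by
    rw [← hcardI]
    refine Set.ncard_le_ncard_of_injOn (fun p => (p.1, D.pos p.2)) ?_ ?_
      (hB.prod (Finset.finite_toSet _))
    · exact fun p hp => ⟨hp.1.1, hpos _ hp.1.2.1⟩
    · rintro ⟨g, h⟩ ⟨hp, hg⟩ ⟨g', h'⟩ ⟨hp', _⟩ heq
      simp only [Prod.mk.injEq] at heq
      obtain ⟨rfl, heq⟩ := heq
      exact Prod.ext rfl (D.eq_of_commute hg hp.2.2 hp'.2.2 heq)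
  have e2 : {p ∈ D.commutingPairs n | D.pos p.2 ≠ 0}.ncard ≤
      (D.ball n).ncard * (2 * (n * C) + 1) := by
    rw [← hcardI]
    refine Set.ncard_le_ncard_of_injOn (fun p => (p.2, D.pos p.1)) ?_ ?_
      (hB.prod (Finset.finite_toSet _))
    · exact fun p hp => ⟨hp.1.2.1, hpos _ hp.1.1⟩
    · rintro ⟨h, g⟩ ⟨hp, hg⟩ ⟨h', g'⟩ ⟨hp', _⟩ heq
      simp only [Prod.mk.injEq] at heq
      obtain ⟨rfl, heq⟩ := heq
      exact Prod.ext (D.eq_of_commute hg hp.2.2.symm hp'.2.2.symm heq) rfl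
  have hsub : D.commutingPairs n ⊆
      ({g ∈ D.ball n | D.pos g = 0} ×ˢ {g ∈ D.ball n | D.pos g = 0}) ∪
        ({p ∈ D.commutingPairs n | D.pos p.1 ≠ 0} ∪ {p ∈ D.commutingPairs n | D.pos p.2 ≠ 0}) := by
    intro p hp
    by_cases h1 : D.pos p.1 = 0
    · by_cases h2 : D.pos p.2 = 0
      · exact .inl ⟨⟨hp.1, h1⟩, ⟨hp.2.1, h2⟩⟩
      · exact .inr (.inr ⟨hp, h2⟩)
    · exact .inr (.inl ⟨hp, h1⟩)
  have hbase : {g ∈ D.ball n | D.pos g = 0}.Finite := hB.subset fun _ hg => hg.1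
  have e3 := (Set.ncard_le_ncard hsub ((hbase.prod hbase).union
    ((hfin.subset fun _ h => h.1).union (hfin.subset fun _ h => h.1)))).trans
      (Set.ncard_union_le _ _)
  have e4 := Set.ncard_union_le {p ∈ D.commutingPairs n | D.pos p.1 ≠ 0}
    {p ∈ D.commutingPairs n | D.pos p.2 ≠ 0}
  rw [Set.ncard_prod] at e3
  have e5 := h₁ n (by omega)
  have e6 := h₂ n (by omega)
  have e7 : {g ∈ D.ball n | D.pos g = 0}.ncard ≤ (D.ball n).ncard :=
    Set.ncard_le_ncard (fun _ h => h.1) hB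
  generalize {g ∈ D.ball n | D.pos g = 0}.ncard = β at *
  generalize (D.ball n).ncard = γ at *
  have e8 : 4 * q * (2 * (n * C) + 1) ≤ γ := by
    refine le_trans ?_ e6
    rw [mul_assoc (4 * q)]
    refine Nat.mul_le_mul_left _ ?_
    have : 1 ≤ n := by omega
    nlinarith
  have e9 : β * β * (2 * q) ≤ γ * γ := by
    calc β * β * (2 * q) = β * (β * (2 * q)) := by ring
      _ ≤ γ * γ := Nat.mul_le_mul e7 (le_trans (Nat.mul_le_mul_left _ (by omega)) e5)
  have e10 : (D.commutingPairs n).ncard ≤ β * β + 2 * (γ * (2 * (n * C) + 1)) := by omega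
  have e11 := Nat.mul_le_mul_right (2 * q) e10
  have e12 := Nat.mul_le_mul_left γ e8
  refine Nat.le_of_mul_le_mul_right (c := 2) ?_ (by omega)
  nlinarith

/-! ### Cayley balls and the limit -/

theorem ball_eq_cayleyBall {S : Set G} (hS : D.gens = S ∪ S⁻¹) (n : ℕ) :
    D.ball n = cayleyBall S n := by
  have to_edist : ∀ {P : ℤ → Prop} {n : ℕ} {x y : G}, D.WordPath P n x y →
      (SimpleGraph.mulCayley S).edist x y ≤ n := by
    intro P n x y h
    induction h with
    | refl n x h => simp
    | step n x s y h hs _ ih =>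
      refine (SimpleGraph.edist_triangle (v := x * s)).trans ?_
      rw [Nat.cast_succ, add_comm]
      refine add_le_add ih ?_
      -- A trivial generator is a step of a path but not an edge of the simple graph.
      rcases eq_or_ne x (x * s) with h1 | h1
      · rw [← h1]
        simp
      · refine (SimpleGraph.edist_eq_one_iff_adj.2 ?_).le
        rw [SimpleGraph.mulCayley_adj']
        rw [hS] at hs
        rcases hs with hs | hs
        · exact ⟨h1, s, hs, .inl rfl⟩
        · exact ⟨h1, s⁻¹, hs, .inr (by simp)⟩
  have of_walk : ∀ {x y : G} (p : (SimpleGraph.mulCayley S).Walk x y),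
      D.WordPath (fun _ => True) p.length x y := by
    intro x y p
    induction p with
    | nil => exact .refl _ _ trivial
    | @cons x z y hadj p ih =>
      rw [SimpleGraph.mulCayley_adj'] at hadj
      obtain ⟨_, s, hs, h | h⟩ := hadj
      · exact .step _ x s y trivial (hS ▸ .inl hs) (h ▸ ih)
      · exact .step _ x s⁻¹ y trivial (hS ▸ .inr (by simpa using hs)) (by simpa [h] using ih)
  ext g
  refine ⟨fun h => to_edist h, fun h => ?_⟩
  have h' : (SimpleGraph.mulCayley S).edist 1 g ≤ n := h
  obtain ⟨p, hp⟩ := SimpleGraph.exists_walk_of_edist_ne_top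
    (ne_top_of_le_ne_top (ENat.natCast_ne_top _) h')
  rw [← hp] at h'
  exact (of_walk p).mono_length (by exact_mod_cast h')

theorem tendsto_commutingRatio {S : Set G} (hS : D.gens = S ∪ S⁻¹) :
    Filter.Tendsto (commutingRatio S) Filter.atTop (nhds 0) := by
  rw [Metric.tendsto_atTop]
  intro ε hε
  obtain ⟨q, hq⟩ := exists_nat_gt (1 / ε)
  have hq0 : (0 : ℝ) < q := (by positivity : (0 : ℝ) < 1 / ε).trans hq
  obtain ⟨N, hN⟩ := D.exists_ncard_commutingPairs_mul_le q
  refine ⟨N, fun n hn => ?_⟩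
  have h1 : ((D.commutingPairs n).ncard : ℝ) * q ≤ ((D.ball n).ncard : ℝ) ^ 2 := by
    exact_mod_cast hN n hn
  have h2 : commutingRatio S n = (D.commutingPairs n).ncard / ((D.ball n).ncard : ℝ) ^ 2 := by
    rw [commutingRatio, ← D.ball_eq_cayleyBall hS]
    rfl
  have h3 : (0 : ℝ) < (D.ball n).ncard := by exact_mod_cast D.ncard_ball_pos n
  rw [Real.dist_eq, sub_zero, h2, abs_of_nonneg (by positivity)]
  refine lt_of_le_of_lt ?_ ((one_div_lt hε hq0).1 hq)
  rw [div_le_div_iff₀ (by positivity) hq0, one_mul]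
  exact h1

end LampWalk

/-! ### The wreath product -/

/-- The restricted wreath product with an infinite cyclic group is of lamplighter type. -/
theorem exists_lampWalk {H T : Type*} [Group H] [Nontrivial H] [Group T] [IsCyclic T] [Infinite T]
    (S : Set (restrictedWreathProduct H T)) (hfin : S.Finite) (hgen : Subgroup.closure S = ⊤) :
    ∃ D : LampWalk (restrictedWreathProduct H T) H, D.gens = S ∪ S⁻¹ := by
  classical
  let e : Multiplicative ℤ ≃* T := intCyclicMulEquiv
  let pos : restrictedWreathProduct H T → ℤ := fun g => Multiplicative.toAdd (e.symm g.1.right)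
  let lamp : restrictedWreathProduct H T → ℤ → H :=
    fun g x => g.1.left (e (Multiplicative.ofAdd x))
  have lamp_finite : ∀ g, ∃ N : ℤ, ∀ x, N < |x| → lamp g x = 1 := by
    intro g
    have hg : (Function.mulSupport g.1.left).Finite := g.2
    obtain ⟨N, hN⟩ := (hg.image fun t => |Multiplicative.toAdd (e.symm t)|).bddAbove
    refine ⟨N, fun x hx => ?_⟩
    by_contra hne
    exact absurd (hN ⟨e (Multiplicative.ofAdd x), hne, by simp⟩) (not_le.2 hx)
  have hgens : (S ∪ S⁻¹).Finite := hfin.union hfin.inv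
  obtain ⟨h, hh⟩ := exists_ne (1 : H)
  choose N hN using lamp_finite
  -- Finitely many generators have a common bound for their moves and their lamps.
  obtain ⟨R, hR⟩ := (hgens.image fun s => max |pos s| (N s)).bddAbove
  have hR' : ∀ s ∈ S ∪ S⁻¹, |pos s| ≤ max R 0 ∧ N s ≤ max R 0 := fun s hs => by
    have := hR ⟨s, hs, rfl⟩
    simp only [sup_le_iff] at this
    exact ⟨this.1.trans (le_max_left _ _), this.2.trans (le_max_left _ _)⟩
  refine ⟨{
    pos := pos
    lamp := lamp
    pos_mul := fun g g' => by simp [pos]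
    lamp_mul := fun g g' x => ?_
    ext := fun g g' h1 h2 => ?_
    lamp_finite := fun g => ⟨N g, hN g⟩
    shift := ⟨⟨1, e (Multiplicative.ofAdd 1)⟩, ?_⟩
    pos_shift := by simp [pos]
    lamp_shift := fun x => by simp [lamp]
    bulb := ⟨⟨Pi.mulSingle 1 h, 1⟩, ?_⟩
    pos_bulb := by simp [pos]
    lamp_bulb_zero := by simpa [lamp] using hh
    lamp_bulb := fun x hx => ?_
    gens := S ∪ S⁻¹
    gens_finite := hgens
    gens_inv := fun s hs => by simpa [or_comm] using hs
    closure_gens := top_le_iff.1 (hgen ▸ Subgroup.closure_mono Set.subset_union_left)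
    reach := max R 0
    reach_nonneg := le_max_right _ _
    pos_gens := fun s hs => (hR' s hs).1
    lamp_gens := fun s hs x hx => hN s x ((hR' s hs).2.trans_lt hx) }, rfl⟩
  · have hx : e (Multiplicative.ofAdd (x - pos g)) =
        g.1.right⁻¹ * e (Multiplicative.ofAdd x) := by
      apply e.symm.injective
      rw [map_mul, map_inv, e.symm_apply_apply, e.symm_apply_apply, mul_comm, ← div_eq_mul_inv,
        ofAdd_sub]
      rfl
    show _ = g.1.left (e (Multiplicative.ofAdd x)) *
      g'.1.left (e (Multiplicative.ofAdd (x - pos g)))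
    rw [hx]
    rfl
  · refine Subtype.ext (RegularWreathProduct.ext (funext fun t => ?_) ?_)
    · simpa [lamp] using h2 (Multiplicative.toAdd (e.symm t))
    · simpa [pos] using h1
  · simp [restrictedWreathProduct]
  · show (Function.mulSupport (Pi.mulSingle (1 : T) h)).Finite
    exact (Set.finite_singleton 1).subset Pi.mulSupport_mulSingle_subset
  · show (Pi.mulSingle 1 h : T → H) (e (Multiplicative.ofAdd x)) = 1
    refine Pi.mulSingle_eq_of_ne ?_ _
    simpa using hx

/-- The restricted wreath product of a nontrivial finitely generated group `H` and an infinite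
cyclic group `T` has degree of commutativity `0` with respect to every finite generating set. -/
theorem theoremA {H T : Type*} [Group H] [Group.FG H] [Nontrivial H]
    [Group T] [IsCyclic T] [Infinite T]
    (S : Set (restrictedWreathProduct H T)) (hfin : S.Finite) (hgen : Subgroup.closure S = ⊤) :
    degreeOfCommutativity S = 0 := by
  obtain ⟨D, hD⟩ := exists_lampWalk S hfin hgen
  exact (D.tendsto_commutingRatio hD).limsup_eq
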